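/- Let $k\ge 1$ be an integer. For $n\ge 1$, an $n$-ary $k$-operation on $\{0,1\}$ is a $k$-tuple $\mathbf f=(\mathbf f^{(1)},\dots,\mathbf f^{(k)})$ of functions $\{0,1\}^n\to\{0,1\}$. The composition of an $m$-ary $k$-operation $\mathbf f$ with $n$-ary $k$-operations $\mathbf g_1,\dots,\mathbf g_m$ is the $n$-ary $k$-operation $\mathbf h$ given by $\mathbf h^{(i)}(x)=\mathbf f^{(i)}\bigl(\mathbf g_1^{(i)}(x),\dots,\mathbf g_m^{(i)}(x)\bigr)$ for $1\le i\le k$ and $x\in\{0,1\}^n$. A $k$-clone on $\{0,1\}$ is a set of $k$-operations of arbitrary arities $n\ge 1$ that is closed under composition and contains, for all $n\ge1$ and $1\le i\le n$, the $k$-projection all of whose $k$ components are the function $(x_1,\dots,x_n)\mapsto x_i$. For a set $\mathcal F$ of $k$-operations, $\mathrm{Clo}^k\mathcal F$ denotes the smallest $k$-clone containing $\mathcal F$. Theorem (Taimanov). Every $k$-clone $\mathcal C$ on $\{0,1\}$ is finitely generated: there is a finite set $\mathcal F$ of $k$-operations with $\mathcal C=\mathrm{Clo}^k\mathcal F$.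 Moreover, the set of all $k$-clones on $\{0,1\}$, ordered by inclusion, satisfies the ascending chain condition: for every infinite chain $\mathcal C_1\subseteq\mathcal C_2\subseteq\mathcal C_3\subseteq\cdots$ of $k$-clones there is $m$ with $\mathcal C_n=\mathcal C_m$ for all $n\ge m$. -/

import Mathlib

/-- A `k`-operation of arity `n` on `A`: a `k`-tuple of functions `Aⁿ → A`. -/
abbrev KOpOfArity (A : Type*) (k n : ℕ) := Fin k → (Fin n → A) → A

/-- The set of all finitary `k`-operations on `A`, of positive arity: the disjoint union over all
`n ≥ 1` of the sets of `n`-ary `k`-operations. -/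
abbrev KOp (A : Type*) (k : ℕ) := Σ n : ℕ+, KOpOfArity A k n

/-- The composition `f(g₁, …, gₘ)` of an `m`-ary `k`-operation `f` with `n`-ary `k`-operations
`g₁, …, gₘ`, taken separately in each of the `k` sorts. -/
def KOpOfArity.comp {A : Type*} {k m n : ℕ} (f : KOpOfArity A k m)
    (g : Fin m → KOpOfArity A k n) : KOpOfArity A k n :=
  fun i x => f i (fun j => g j i x)

/-- The `k`-projection of arity `n` onto the coordinate `i`. -/
def KOpOfArity.proj (A : Type*) (k : ℕ) {n : ℕ} (i : Fin n) : KOpOfArity A k n :=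
  fun _ x => x i

/-- A `k`-clone on `A`: a set of `k`-operations which contains all `k`-projections and is closed
under composition. -/
structure IsKClone {A : Type*} {k : ℕ} (C : Set (KOp A k)) : Prop where
  proj_mem : ∀ (n : ℕ+) (i : Fin n), (⟨n, KOpOfArity.proj A k i⟩ : KOp A k) ∈ C
  comp_mem : ∀ (m n : ℕ+) (f : KOpOfArity A k m) (g : Fin m → KOpOfArity A k n),
    (⟨m, f⟩ : KOp A k) ∈ C → (∀ j, (⟨n, g j⟩ : KOp A k) ∈ C) →
      (⟨n, f.comp g⟩ : KOp A k) ∈ C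

/-- The `k`-clone generated by a set `F` of `k`-operations: the intersection of all `k`-clones
that contain `F`. -/
def kClo {A : Type*} {k : ℕ} (F : Set (KOp A k)) : Set (KOp A k) :=
  ⋂₀ {C | IsKClone C ∧ F ⊆ C}

/-- `kClo F` is the smallest `k`-clone that contains `F`. -/
theorem kClo_isLeast {A : Type*} {k : ℕ} (F : Set (KOp A k)) :
    IsLeast {C | IsKClone C ∧ F ⊆ C} (kClo F) := by
  refine ⟨⟨⟨?_, ?_⟩, ?_⟩, fun C hC => Set.sInter_subset_of_mem hC⟩
  · intro n i C hC
    exact hC.1.proj_mem n i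
  · intro m n f g hf hg C hC
    exact hC.1.comp_mem m n f g (hf C hC) (fun j => hg j C hC)
  · intro f hf C hC
    exact hC.2 hf

/-- A set of `k`-operations is finitely generated with respect to `kClo` if it is the `k`-clone
generated by some finite set of `k`-operations. -/
def IsFinitelyGeneratedKClone {A : Type*} {k : ℕ} (C : Set (KOp A k)) : Prop :=
  ∃ F : Set (KOp A k), F.Finite ∧ kClo F = C

/-- The ascending chain condition: every infinite ascending chain `p₀ ≤ p₁ ≤ p₂ ≤ …` is
eventually constant. -/
def SatisfiesACC (P : Type*) [PartialOrder P] : Prop :=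
  ∀ p : ℕ → P, (∀ n, p n ≤ p (n + 1)) → ∃ m, ∀ n, m ≤ n → p m = p n

/-! The chain condition follows from finite generation: the union of a chain is a clone, and its
finite generating set already lies in one member. For finite generation, let `B` be a proper
subclone of `C` with the same unary members. An operation of `C` outside `B` can be normalized by a
unary member, giving `f` outside `B`. Take a minimal set of points such that every operation of `B`
of the arity of `f` disagrees with `f` at one of them. The disagreement ("fault") sets include all
singletons, exclude the empty set, and are closed under the ternary operations of `B` that are
idempotent on the nonconstant sorts of `f`. A combinatorial analysis
(`FaultSystem.exists_parity_set`) finds a set `L` of non-monotone coordinates whose subsets are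
fault sets exactly when they are odd, while sets not inside `L` with at most one monotone coordinate
are all fault sets. Hence `f` violates the relation "a fault outside `L`, or an odd number of
faults", whereas every normalized member of `B` with the same constant sorts preserves it
(`exists_violation`). Up to reordering, such a relation is given by counting its coordinates of each
of finitely many colours. If `C` were not finitely generated, adjoining violators forever would give
an infinite sequence. Dickson's lemma then finds an earlier and a later term with equal constant
sorts and with counts that increase and agree modulo 2. Padding by evenly many coordinates of each
colour carries the earlier violation to the later relation (`Violates.lift`), which the earlier
operation must preserve: a contradiction. -/

/-! ### Fault systems and their parity structure -/

/-- A family of subsets of `Q` (fault sets), closed under a set of coordinatewise ternary Boolean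
operations that are idempotent; it contains the singletons but not the empty set. -/
structure FaultSystem {Q : Type*} [Fintype Q] [DecidableEq Q]
    (T : Set (Q → Bool → Bool → Bool → Bool)) (F : Set (Finset Q)) : Prop where
  idem : ∀ d ∈ T, ∀ q x, d q x x x = x
  reverse_mem : ∀ d ∈ T, (fun q x y z => d q z y x) ∈ T
  closed : ∀ d ∈ T, ∀ A ∈ F, ∀ B ∈ F, ∀ C ∈ F,
    Finset.univ.filter (fun q => d q (decide (q ∈ A)) (decide (q ∈ B)) (decide (q ∈ C)) = true) ∈ F
  empty_notMem : ∅ ∉ F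
  singleton_mem : ∀ q, {q} ∈ F

namespace FaultSystem

variable {Q : Type*} [Fintype Q] [DecidableEq Q]
  {T : Set (Q → Bool → Bool → Bool → Bool)} {F : Set (Finset Q)}

set_option linter.unusedSectionVars false

theorem mem_of (h : FaultSystem T F) {d} (hd : d ∈ T) {A B C P : Finset Q}
    (hA : A ∈ F) (hB : B ∈ F) (hC : C ∈ F)
    (hP : ∀ q, decide (q ∈ P) = d q (decide (q ∈ A)) (decide (q ∈ B)) (decide (q ∈ C))) :
    P ∈ F := by
  have := h.closed d hd A hA B hB C hC
  convert this using 1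
  ext q
  simp [← hP q]

/-- The coordinate `q` is non-monotone for some operation of `T`. -/
def NonMono (T : Set (Q → Bool → Bool → Bool → Bool)) (q : Q) : Prop :=
  ∃ d ∈ T, d q false true true = false ∧ d q false false true = true

/-- Two coordinates are linked if they cannot be faulty simultaneously. -/
def Linked (F : Set (Finset Q)) (p q : Q) : Prop := p ≠ q ∧ ({p, q} : Finset Q) ∉ F

theorem Linked.symm {p q : Q} (h : Linked F p q) : Linked F q p :=
  ⟨h.1.symm, by rw [Finset.pair_comm]; exact h.2⟩

/-- Feed `d` three rows, each `{p}` or `{q}`. By idempotence the output lies inside `{p, q}`; it is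
neither empty nor the whole pair, so exactly one of the two coordinates survives. -/
theorem Linked.dual (h : FaultSystem T F) {p q : Q} (hl : Linked F p q) {d} (hd : d ∈ T)
    (x y z : Bool) : d q (!x) (!y) (!z) = !d p x y z := by
  have key : ∀ P : Finset Q, (∀ r, r ∈ P ↔ (r = p ∧ d p x y z = true) ∨
      (r = q ∧ d q (!x) (!y) (!z) = true)) → P ∈ F := by
    intro P hP
    have hr : ∀ x : Bool, (if x then ({p} : Finset Q) else {q}) ∈ F := by
      intro x; cases x <;> simp [h.singleton_mem]
    have hm : ∀ (x : Bool) r, decide (r ∈ (if x then ({p} : Finset Q) else {q})) =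
        if r = p then x else if r = q then !x else false := by
      intro x r
      by_cases h1 : r = p
      · subst h1; cases x <;> simp [hl.1]
      · by_cases h2 : r = q
        · subst h2; cases x <;> simp [h1]
        · cases x <;> simp [h1, h2]
    refine h.mem_of hd (hr x) (hr y) (hr z) fun r => ?_
    rw [hm, hm, hm]
    by_cases h1 : r = p
    · subst h1; simp [hP, hl.1]
    · by_cases h2 : r = q
      · subst h2; simp [hP, h1]
      · simp [hP, h1, h2, h.idem d hd]
  cases h1 : d p x y z <;> cases h2 : d q (!x) (!y) (!z) <;> simp only [Bool.not_true, Bool.not_false]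
  · exact absurd (key ∅ (by simp [h1, h2])) h.empty_notMem
  · exact absurd (key {p, q} (by simp [h1, h2])) hl.2

theorem Linked.nonMono (h : FaultSystem T F) {p q : Q} (hl : Linked F p q) (hp : NonMono T p) :
    NonMono T q := by
  obtain ⟨d, hd, h1, h2⟩ := hp
  refine ⟨_, h.reverse_mem d hd, ?_, ?_⟩
  · simpa [h2] using hl.dual h hd false false true
  · simpa [h1] using hl.dual h hd false true true

/-- At `p` the non-monotone operation turns on directly, and at `q` it does so by duality; all other
coordinates are constant across the rows. -/
theorem insert_pair_mem (h : FaultSystem T F) {p q : Q} (hl : Linked F p q) (hp : NonMono T p)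
    {P : Finset Q} (hpP : p ∉ P) (hqP : q ∉ P) (h0 : P ∈ F) (h1 : insert p P ∈ F)
    (h2 : insert q P ∈ F) : insert p (insert q P) ∈ F := by
  obtain ⟨d, hd, e1, e2⟩ := hp
  have e3 := hl.dual h hd false true true
  refine h.mem_of hd h2 h0 h1 fun r => ?_
  by_cases hr : r = p
  · subst hr; simp [hl.1, hpP, e2]
  · by_cases hr' : r = q
    · subst hr'; simp [hr, hqP, e1] at e3 ⊢; exact e3
    · simp [hr, hr', h.idem d hd]

theorem erase_pair_mem (h : FaultSystem T F) {p q : Q} (hl : Linked F p q) (hp : NonMono T p)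
    {P : Finset Q} (hpP : p ∈ P) (hqP : q ∈ P) (h0 : P ∈ F) (h1 : P.erase p ∈ F)
    (h2 : P.erase q ∈ F) : (P.erase p).erase q ∈ F := by
  obtain ⟨d, hd, e1, e2⟩ := hp
  have e3 := hl.dual h hd false false true
  refine h.mem_of hd h1 h0 h2 fun r => ?_
  by_cases hr : r = p
  · subst hr; simp [hl.1, hpP, e1]
  · by_cases hr' : r = q
    · subst hr'; simp [hr, hqP, e2] at e3 ⊢; exact e3
    · simp [hr, hr', h.idem d hd]

/-- If `{q, r}` were a member, applying the operation that is non-monotone at `q` to `{p}`, `{r}`,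
`{q, r}` would produce the forbidden `{p, q}`. -/
theorem Linked.trans (h : FaultSystem T F) {p q r : Q} (hpq : Linked F p q) (hpr : Linked F p r)
    (hqr : q ≠ r) (hq : NonMono T q) : Linked F q r := by
  refine ⟨hqr, fun hmem => hpq.2 ?_⟩
  obtain ⟨d, hd, e1, e2⟩ := hq
  have e3 := hpq.symm.dual h hd false true true
  have e4 := hpr.dual h hd true false false
  refine h.mem_of hd (h.singleton_mem p) (h.singleton_mem r) hmem fun s => ?_
  by_cases hs : s = p
  · subst hs; simp [hpq.1, hpr.1, e1] at e3 ⊢; exact e3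
  · by_cases hs' : s = q
    · subst hs'; simp [hs, hqr, e2]
    · by_cases hs'' : s = r
      · subst hs''; simp [e1] at e3; simp [e3] at e4; simp [hs, hs', e4]
      · simp [hs, hs', hs'', h.idem d hd]

theorem mem_of_three (h : FaultSystem T F) {p q r : Q} (hpq : p ≠ q) (hpr : p ≠ r) (hqr : q ≠ r)
    (hq : NonMono T q) {P : Finset Q} (hp' : p ∈ P) (hq' : q ∈ P) (hr' : r ∈ P)
    (hP : ∀ P' ⊂ P, P'.Nonempty → P' ∈ F) : P ∈ F := by
  obtain ⟨d, hd, e1, e2⟩ := hq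
  -- Otherwise the rows `{r}`, `{q}`, `{q}` would yield the empty set.
  have e3 : d r true false false = true := by
    by_contra e3
    refine h.empty_notMem (h.mem_of hd (h.singleton_mem r) (h.singleton_mem q)
      (h.singleton_mem q) fun s => ?_)
    by_cases hs : s = q
    · subst hs; simp [hqr, e1]
    · by_cases hs' : s = r
      · subst hs'; simp [hs, e3]
      · simp [hs, hs', h.idem d hd]
  have m : ∀ P' : Finset Q, P' ⊆ P → p ∈ P' → (q ∉ P' ∨ r ∉ P') → P' ∈ F := by
    intro P' h1 h2 h3
    refine hP P' ⟨h1, fun h4 => ?_⟩ ⟨p, h2⟩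
    rcases h3 with h3 | h3
    · exact h3 (h4 hq')
    · exact h3 (h4 hr')
  have m1 : P.erase q ∈ F := m _ (Finset.erase_subset _ _) (by simp [hpq, hp']) (by simp)
  have m2 : (P.erase q).erase r ∈ F := m _
    ((Finset.erase_subset _ _).trans (Finset.erase_subset _ _)) (by simp [hpq, hpr, hp']) (by simp)
  have m3 : P.erase r ∈ F := m _ (Finset.erase_subset _ _) (by simp [hpr, hp']) (by simp)
  refine h.mem_of hd m1 m2 m3 fun s => ?_
  by_cases hs : s = q
  · subst hs; simp [hqr, hq', e2]
  · by_cases hs' : s = r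
    · subst hs'; simp [hs, hr', e3]
    · simp [hs, hs', h.idem d hd]

/-- The rows `insert r P`, `insert p P`, `insert q P` switch on both `q` and `r`. Only the value at
`p` is in doubt, and the wrong value would give the excluded set. -/
theorem mem_of_linked_three (h : FaultSystem T F) {p q r : Q} (hqr : Linked F q r) (hpq : p ≠ q)
    (hpr : p ≠ r) (hq : NonMono T q) {P : Finset Q} (hp' : p ∉ P) (hq' : q ∉ P) (hr' : r ∉ P)
    (h1 : insert p P ∈ F) (h2 : insert q P ∈ F) (h3 : insert r P ∈ F)
    (h4 : insert q (insert r P) ∉ F) : insert p (insert q (insert r P)) ∈ F := by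
  obtain ⟨d, hd, e1, e2⟩ := hq
  have e3 := hqr.dual h hd false true true
  simp [e1] at e3
  have key : ∀ P', (∀ s, decide (s ∈ P') = d s (decide (s ∈ insert r P))
      (decide (s ∈ insert p P)) (decide (s ∈ insert q P))) → P' ∈ F :=
    fun P' => h.mem_of hd h3 h1 h2
  have hpn : d p false true false = true := by
    by_contra e4
    refine h4 (key _ fun s => ?_)
    by_cases hs : s = q
    · subst hs; simp [hqr.1, hpq.symm, hq', e2]
    · by_cases hs' : s = r
      · subst hs'; simp [hs, hpr.symm, hr', e3]
      · by_cases hs'' : s = p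
        · subst hs''; simp [hs, hs', hp', e4]
        · simp [hs, hs', hs'', h.idem d hd]
  refine key _ fun s => ?_
  by_cases hs : s = q
  · subst hs; simp [hqr.1, hpq.symm, hq', e2]
  · by_cases hs' : s = r
    · subst hs'; simp [hs, hpr.symm, hr', e3]
    · by_cases hs'' : s = p
      · subst hs''; simp [hs, hs', hp', hpn]
      · simp [hs, hs', hs'', h.idem d hd]

/-- Membership on the four coordinates would be the disjunction "the first pair is split or the
second is", where split means containing exactly one element of the pair. A non-monotone self-dual
operation cannot preserve such a disjunction. -/
theorem false_of_two_pairs (h : FaultSystem T F) {p₁ p₂ p₃ p₄ : Q} (h12 : Linked F p₁ p₂)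
    (h34 : Linked F p₃ p₄) (hp₁ : NonMono T p₁) (hp₃ : NonMono T p₃)
    (n13 : p₁ ≠ p₃) (n14 : p₁ ≠ p₄) (n23 : p₂ ≠ p₃) (n24 : p₂ ≠ p₄)
    (m13 : {p₁, p₃} ∈ F) (m14 : {p₁, p₄} ∈ F) (m23 : {p₂, p₃} ∈ F) (m24 : {p₂, p₄} ∈ F) :
    False := by
  have n12 := h12.1
  have n34 := h34.1
  have t123 : ({p₁, p₂, p₃} : Finset Q) ∈ F :=
    h.insert_pair_mem h12 hp₁ (by simp [n13]) (by simp [n23]) (h.singleton_mem p₃) m13 m23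
  have t124 : ({p₁, p₂, p₄} : Finset Q) ∈ F :=
    h.insert_pair_mem h12 hp₁ (by simp [n14]) (by simp [n24]) (h.singleton_mem p₄) m14 m24
  have t341 : ({p₃, p₄, p₁} : Finset Q) ∈ F :=
    h.insert_pair_mem h34 hp₃ (by simp [n13.symm]) (by simp [n14.symm]) (h.singleton_mem p₁)
      (by rw [Finset.pair_comm]; exact m13) (by rw [Finset.pair_comm]; exact m14)
  have t342 : ({p₃, p₄, p₂} : Finset Q) ∈ F :=
    h.insert_pair_mem h34 hp₃ (by simp [n23.symm]) (by simp [n24.symm]) (h.singleton_mem p₂)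
      (by rw [Finset.pair_comm]; exact m23) (by rw [Finset.pair_comm]; exact m24)
  by_cases hall : ({p₁, p₂, p₃, p₄} : Finset Q) ∈ F
  · refine h12.2 ?_
    have := h.erase_pair_mem h34 hp₃ (P := {p₁, p₂, p₃, p₄}) (by simp) (by simp) hall
      (by convert t124 using 1; ext s; simp; grind) (by convert t123 using 1; ext s; simp; grind)
    convert this using 1; ext s; simp; grind
  · obtain ⟨S, hS⟩ : ∃ S : Bool → Bool → Bool → Bool → Finset Q, ∀ b₁ b₂ b₃ b₄ s,
        decide (s ∈ S b₁ b₂ b₃ b₄) = if s = p₁ then b₁ else if s = p₂ then b₂ else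
          if s = p₃ then b₃ else if s = p₄ then b₄ else false :=
      ⟨fun b₁ b₂ b₃ b₄ => Finset.univ.filter fun s => (if s = p₁ then b₁ else if s = p₂ then b₂ else
          if s = p₃ then b₃ else if s = p₄ then b₄ else false) = true, by simp⟩
    have mem_iff : ∀ b₁ b₂ b₃ b₄ s, s ∈ S b₁ b₂ b₃ b₄ ↔ (if s = p₁ then b₁ else if s = p₂ then b₂
        else if s = p₃ then b₃ else if s = p₄ then b₄ else false) = true := by
      intro b₁ b₂ b₃ b₄ s; rw [← hS]; simp
    have eqS : ∀ b₁ b₂ b₃ b₄ P, (∀ s, s ∈ P ↔ (if s = p₁ then b₁ else if s = p₂ then b₂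
        else if s = p₃ then b₃ else if s = p₄ then b₄ else false) = true) → S b₁ b₂ b₃ b₄ = P := by
      intro b₁ b₂ b₃ b₄ P hP
      ext s; rw [mem_iff, hP]
    have row : ∀ b₁ b₂ b₃ b₄, (b₁ = !b₂ ∨ b₃ = !b₄) → S b₁ b₂ b₃ b₄ ∈ F := by
      intro b₁ b₂ b₃ b₄ hb
      cases b₁ <;> cases b₂ <;> cases b₃ <;> cases b₄ <;> simp at hb
      · rw [eqS _ _ _ _ {p₄} (by grind)]; exact h.singleton_mem _
      · rw [eqS _ _ _ _ {p₃} (by grind)]; exact h.singleton_mem _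
      · rw [eqS _ _ _ _ {p₂} (by grind)]; exact h.singleton_mem _
      · rw [eqS _ _ _ _ {p₂, p₄} (by grind)]; exact m24
      · rw [eqS _ _ _ _ {p₂, p₃} (by grind)]; exact m23
      · rw [eqS _ _ _ _ {p₃, p₄, p₂} (by grind)]; exact t342
      · rw [eqS _ _ _ _ {p₁} (by grind)]; exact h.singleton_mem _
      · rw [eqS _ _ _ _ {p₁, p₄} (by grind)]; exact m14
      · rw [eqS _ _ _ _ {p₁, p₃} (by grind)]; exact m13
      · rw [eqS _ _ _ _ {p₃, p₄, p₁} (by grind)]; exact t341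
      · rw [eqS _ _ _ _ {p₁, p₂, p₄} (by grind)]; exact t124
      · rw [eqS _ _ _ _ {p₁, p₂, p₃} (by grind)]; exact t123
    have bad : ∀ b₁ b₂ b₃ b₄, b₁ = b₂ → b₃ = b₄ → S b₁ b₂ b₃ b₄ ∉ F := by
      rintro b₁ _ b₃ _ rfl rfl
      cases b₁ <;> cases b₃
      · rw [eqS _ _ _ _ ∅ (by grind)]; exact h.empty_notMem
      · rw [eqS _ _ _ _ {p₃, p₄} (by grind)]; exact h34.2
      · rw [eqS _ _ _ _ {p₁, p₂} (by grind)]; exact h12.2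
      · rw [eqS _ _ _ _ {p₁, p₂, p₃, p₄} (by grind)]; exact hall
    obtain ⟨d, hd, e1, e2⟩ := hp₁
    have d2 := fun x y z => h12.dual h hd x y z
    have d4 := fun x y z => h34.dual h hd x y z
    have key : ∀ x₁ y₁ z₁ x₂ y₂ z₂ x₃ y₃ z₃ x₄ y₄ z₄ : Bool, (x₁ = !x₂ ∨ x₃ = !x₄) →
        (y₁ = !y₂ ∨ y₃ = !y₄) → (z₁ = !z₂ ∨ z₃ = !z₄) → d p₁ x₁ y₁ z₁ = d p₂ x₂ y₂ z₂ →
        d p₃ x₃ y₃ z₃ = d p₄ x₄ y₄ z₄ → False := by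
      intro x₁ y₁ z₁ x₂ y₂ z₂ x₃ y₃ z₃ x₄ y₄ z₄ hx hy hz h1 h3
      refine bad _ _ _ _ h1 h3 (h.mem_of hd (row _ _ _ _ hx) (row _ _ _ _ hy) (row _ _ _ _ hz)
        fun s => ?_)
      simp only [hS]
      split_ifs <;> first | (subst_vars; rfl) | simp [h.idem d hd]
    have i1 := h.idem d hd p₁
    have i3 := h.idem d hd p₃
    have d2a := d2 false false false
    have d2b := d2 false false true
    have d2c := d2 false true true
    have d2d := d2 true true true
    have d4a := d4 false false false
    have d4b := d4 false false true
    have d4c := d4 false true true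
    have d4d := d4 true true true
    simp only [Bool.not_true, Bool.not_false, i1, i3, e1, e2] at d2a d2b d2c d2d d4a d4b d4c d4d
    -- In each case every row splits at least one pair, but the output splits neither.
    cases c1 : d p₃ false false true
    · cases c2 : d p₃ false true true
      · exact key false false false true true false false true true false false false
          (by simp) (by simp) (by simp) (by simp [i1, d2b]) (by simp [c2, d4d])
      · exact key false false false true true false false false true true false false
          (by simp) (by simp) (by simp) (by simp [i1, d2b]) (by simp [c1, d4c, c2])
    · exact key false false true true false false false false false true true false
          (by simp) (by simp) (by simp) (by simp [e2, d2c]) (by simp [i3, d4b, c1])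

theorem Linked.eq_or_linked (h : FaultSystem T F) {p₁ p₂ p₃ p₄ : Q} (h12 : Linked F p₁ p₂)
    (h34 : Linked F p₃ p₄) (hp₁ : NonMono T p₁) (hp₃ : NonMono T p₃) :
    p₁ = p₃ ∨ Linked F p₁ p₃ := by
  by_contra hcon
  rw [not_or] at hcon
  obtain ⟨n13, l13⟩ := hcon
  have n14 : p₁ ≠ p₄ := by rintro rfl; exact l13 h34.symm
  have l14 : ¬Linked F p₁ p₄ := fun l => l13 (Linked.trans h l.symm h34.symm n13 hp₁)
  have n23 : p₂ ≠ p₃ := by rintro rfl; exact l13 h12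
  have l23 : ¬Linked F p₂ p₃ := fun l => l13 (Linked.trans h h12.symm l n13 hp₁)
  have n24 : p₂ ≠ p₄ := by rintro rfl; exact l13 (Linked.trans h h12.symm h34.symm n13 hp₁)
  have l24 : ¬Linked F p₂ p₄ := fun l => l14 (Linked.trans h h12.symm l n14 hp₁)
  exact h.false_of_two_pairs h12 h34 hp₁ hp₃ n13 n14 n23 n24
    (by_contra fun m => l13 ⟨n13, m⟩) (by_contra fun m => l14 ⟨n14, m⟩)
    (by_contra fun m => l23 ⟨n23, m⟩) (by_contra fun m => l24 ⟨n24, m⟩)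

/-- Linkedness is transitive on non-monotone coordinates and two separate linked pairs cannot
coexist, so there is at most one nontrivial class. -/
theorem exists_linked_class (h : FaultSystem T F) : ∃ L : Finset Q, (∀ q ∈ L, NonMono T q) ∧
    (∀ p ∈ L, ∀ q ∈ L, p ≠ q → Linked F p q) ∧ ∀ p q, NonMono T p → Linked F p q → p ∈ L := by
  classical
  by_cases hex : ∃ p q, NonMono T p ∧ Linked F p q
  · obtain ⟨p, q, hp, hpq⟩ := hex
    have hN : ∀ r, Linked F p r → NonMono T r := fun r hr => hr.nonMono h hp
    refine ⟨Finset.univ.filter fun r => p = r ∨ Linked F p r, ?_, ?_, ?_⟩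
    · intro r hr
      rcases (Finset.mem_filter.1 hr).2 with rfl | hr
      · exact hp
      · exact hN r hr
    · intro r hr s hs hrs
      rcases (Finset.mem_filter.1 hr).2 with rfl | hr <;>
        rcases (Finset.mem_filter.1 hs).2 with rfl | hs
      · exact absurd rfl hrs
      · exact hs
      · exact hr.symm
      · exact hr.trans h hs hrs (hN r hr)
    · intro r s hr hrs
      simpa using Linked.eq_or_linked h hpq hrs hp hr
  · push Not at hex
    exact ⟨∅, by simp, by simp, fun p q hp hpq => absurd hpq (hex p q hp)⟩

/-- Pairs are members because they are not linked; a set of three or more elements contains a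
suitable non-monotone one, so `mem_of_three` reduces it to proper subsets. -/
theorem mem_of_not_linked (h : FaultSystem T F) (P : Finset Q) (hne : P.Nonempty)
    (hN : ∀ p ∈ P, ∀ q ∈ P, ¬NonMono T p → ¬NonMono T q → p = q)
    (hL : ∀ p ∈ P, ∀ q ∈ P, ¬Linked F p q) : P ∈ F := by
  induction P using Finset.strongInduction with
  | H P ih =>
    by_cases h3 : 2 < P.card
    · obtain ⟨a, b, c, ha, hb, hc, hab, hac, hbc⟩ := Finset.two_lt_card_iff.1 h3
      have hsub : ∀ P' ⊂ P, P'.Nonempty → P' ∈ F := fun P' hP' hne' =>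
        ih P' hP' hne' (fun p hp q hq => hN p (hP'.1 hp) q (hP'.1 hq))
          (fun p hp q hq => hL p (hP'.1 hp) q (hP'.1 hq))
      by_cases hbN : NonMono T b
      · exact h.mem_of_three hab hac hbc hbN ha hb hc hsub
      · have haN : NonMono T a := by
          by_contra haN
          exact hab (hN a ha b hb haN hbN)
        exact h.mem_of_three hab.symm hbc hac haN hb ha hc hsub
    · have hc := hne.card_pos
      have : P.card = 1 ∨ P.card = 2 := by omega
      rcases this with h1 | h2
      · obtain ⟨a, rfl⟩ := Finset.card_eq_one.1 h1
        exact h.singleton_mem a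
      · obtain ⟨a, b, hab, rfl⟩ := Finset.card_eq_two.1 h2
        exact by_contra fun hm => hL a (by simp) b (by simp) ⟨hab, hm⟩

/-- The structure of fault systems: on the non-monotone coordinates, the only possible obstruction
is a parity condition on one set of coordinates. -/
theorem exists_parity_set (h : FaultSystem T F) : ∃ L : Finset Q, (∀ q ∈ L, NonMono T q) ∧
    (∀ P ⊆ L, P ∈ F ↔ Odd P.card) ∧
    ∀ P : Finset Q, ¬P ⊆ L →
      (∀ p ∈ P, ∀ q ∈ P, ¬NonMono T p → ¬NonMono T q → p = q) → P ∈ F := by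
  obtain ⟨L, hLN, hLL, hL⟩ := h.exists_linked_class
  refine ⟨L, hLN, fun P => ?_, fun P => ?_⟩
  · induction P using Finset.strongInduction with
    | H P ih =>
      intro hPL
      rcases Nat.lt_or_ge P.card 3 with hlt | hge
      · have : P.card = 0 ∨ P.card = 1 ∨ P.card = 2 := by omega
        rcases this with h0 | h1 | h2
        · obtain rfl := Finset.card_eq_zero.1 h0
          simp [h.empty_notMem]
        · obtain ⟨a, rfl⟩ := Finset.card_eq_one.1 h1
          simp [h.singleton_mem]
        · obtain ⟨a, b, hab, rfl⟩ := Finset.card_eq_two.1 h2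
          have := (hLL a (hPL (by simp)) b (hPL (by simp)) hab).2
          rw [h2]
          exact iff_of_false this (by decide)
      · obtain ⟨a, b, c, ha, hb, hc, hab, hac, hbc⟩ := Finset.two_lt_card_iff.1 hge
        have ih' : ∀ P', P' ⊂ P → (P' ∈ F ↔ Odd P'.card) :=
          fun P' hP' => ih P' hP' (hP'.1.trans hPL)
        have hbc' := hLL b (hPL hb) c (hPL hc) hbc
        have ssub : ∀ P' ⊆ P, ∀ s ∈ P, s ∉ P' → P' ⊂ P :=
          fun P' h1 s h2 h3 => ⟨h1, fun h4 => h3 (h4 h2)⟩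
        rcases Nat.even_or_odd P.card with he | ho
        · refine iff_of_false (fun hP => ?_) (Nat.not_odd_iff_even.2 he)
          have o : ∀ x ∈ P, P.erase x ∈ F := fun x hx => by
            rw [ih' _ (Finset.erase_ssubset hx), Finset.card_erase_of_mem hx]
            have := Nat.even_iff.1 he
            rw [Nat.odd_iff]
            omega
          have := h.erase_pair_mem hbc' (hLN b (hPL hb)) hb hc hP (o b hb) (o c hc)
          rw [ih' _ (ssub _ ((Finset.erase_subset _ _).trans (Finset.erase_subset _ _)) c hc
            (by simp)), Finset.card_erase_of_mem (by simp [hbc.symm, hc]),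
            Finset.card_erase_of_mem hb] at this
          rw [Nat.odd_iff] at this
          rw [Nat.even_iff] at he
          omega
        · refine iff_of_true ?_ ho
          obtain ⟨P₀, ha₀, hb₀, hc₀, rfl⟩ : ∃ P₀ : Finset Q, a ∉ P₀ ∧ b ∉ P₀ ∧ c ∉ P₀ ∧
              P = insert a (insert b (insert c P₀)) :=
            ⟨((P.erase a).erase b).erase c, by simp, by simp, by simp, by
              ext s; simp only [Finset.mem_insert, Finset.mem_erase]; grind⟩
          have hcard : (insert a (insert b (insert c P₀))).card = P₀.card + 3 := by
            rw [Finset.card_insert_of_notMem (by simp [*]),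
              Finset.card_insert_of_notMem (by simp [*]), Finset.card_insert_of_notMem hc₀]
          rw [hcard, Nat.odd_iff] at ho
          have i1 : insert a P₀ ∈ F := by
            rw [ih' _ (ssub _ (by intro s; simp; grind) b (by simp) (by simp [*, hab.symm])),
              Finset.card_insert_of_notMem ha₀, Nat.odd_iff]; omega
          have i2 : insert b P₀ ∈ F := by
            rw [ih' _ (ssub _ (by intro s; simp; grind) a (by simp) (by simp [*])),
              Finset.card_insert_of_notMem hb₀, Nat.odd_iff]; omega
          have i3 : insert c P₀ ∈ F := by
            rw [ih' _ (ssub _ (by intro s; simp; grind) a (by simp) (by simp [*])),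
              Finset.card_insert_of_notMem hc₀, Nat.odd_iff]; omega
          refine h.mem_of_linked_three hbc' hab hac (hLN b (hPL hb)) ha₀ hb₀ hc₀ i1 i2 i3 ?_
          rw [ih' _ (ssub _ (by intro s; simp; grind) a (by simp) (by simp [*])),
            Finset.card_insert_of_notMem (by simp [*]), Finset.card_insert_of_notMem hc₀,
            Nat.odd_iff]
          omega
  · induction P using Finset.strongInduction with
    | H P ih =>
      intro hPL hN
      -- Two elements of `L` can be removed and restored by `insert_pair_mem`: the smaller sets
      -- still meet the complement of `L`.
      by_cases hex : ∃ p ∈ P, ∃ q ∈ P, p ∈ L ∧ q ∈ L ∧ p ≠ q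
      · obtain ⟨p, hp, q, hq, hpL, hqL, hpq⟩ := hex
        obtain ⟨P₀, hp₀, hq₀, rfl⟩ : ∃ P₀ : Finset Q, p ∉ P₀ ∧ q ∉ P₀ ∧ P = insert p (insert q P₀) :=
          ⟨(P.erase p).erase q, by simp, by simp, by
            ext s; simp only [Finset.mem_insert, Finset.mem_erase]; grind⟩
        have ih' : ∀ P', P' ⊂ insert p (insert q P₀) → P₀ ⊆ P' → P' ∈ F := by
          intro P' h1 h2
          refine ih P' h1 (fun h3 => hPL ?_) fun a ha b hb => hN a (h1.1 ha) b (h1.1 hb)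
          exact Finset.insert_subset hpL (Finset.insert_subset hqL (h2.trans h3))
        have ssub : ∀ P', P' ⊆ insert p (insert q P₀) → ∀ s ∈ insert p (insert q P₀), s ∉ P' →
            P' ⊂ insert p (insert q P₀) :=
          fun P' h1 s h2 h3 => ⟨h1, fun h4 => h3 (h4 h2)⟩
        exact h.insert_pair_mem (hLL p hpL q hqL hpq) (hLN p hpL) hp₀ hq₀
          (ih' _ (ssub _ (by intro s; simp; grind) p (by simp) hp₀) subset_rfl)
          (ih' _ (ssub _ (by intro s; simp; grind) q (by simp) (by simp [hq₀, hpq.symm]))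
            (Finset.subset_insert _ _))
          (ih' _ (ssub _ (by intro s; simp; grind) p (by simp) (by simp [hp₀, hpq]))
            (Finset.subset_insert _ _))
      · refine h.mem_of_not_linked P ?_ hN fun p hp q hq hpq => ?_
        · rw [Finset.nonempty_iff_ne_empty]
          rintro rfl
          exact hPL (Finset.empty_subset _)
        · have hpN : NonMono T p ∨ NonMono T q := by
            by_contra hcon
            rw [not_or] at hcon
            exact hpq.1 (hN p hp q hq hcon.1 hcon.2)
          have hpN' : NonMono T p := hpN.elim id fun hqN => hpq.symm.nonMono h hqN
          exact hex ⟨p, hp, q, hq, hL p q hpN' hpq,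
            hL q p (hpq.nonMono h hpN') hpq.symm, hpq.1⟩

end FaultSystem

/-! ### Composition with members of a clone -/

/-- Membership of an operation whose arity is given as a natural number. -/
def KMem {A : Type*} {k : ℕ} (B : Set (KOp A k)) {n : ℕ} (g : KOpOfArity A k n) : Prop :=
  ∃ hn : 0 < n, (⟨⟨n, hn⟩, g⟩ : KOp A k) ∈ B

theorem KMem.comp {A : Type*} {k : ℕ} {B : Set (KOp A k)} (hB : IsKClone B) {m n : ℕ}
    {f : KOpOfArity A k m} (hf : KMem B f) {g : Fin m → KOpOfArity A k n}
    (hg : ∀ j, KMem B (g j)) : KMem B (fun i x => f i (fun j => g j i x) : KOpOfArity A k n) := by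
  obtain ⟨hm, hf⟩ := hf
  obtain ⟨hn, -⟩ := hg ⟨0, hm⟩
  exact ⟨hn, hB.comp_mem ⟨m, hm⟩ ⟨n, hn⟩ f g hf fun j => (hg j).2⟩

theorem KMem.proj {A : Type*} {k : ℕ} {B : Set (KOp A k)} (hB : IsKClone B) {n : ℕ} (j : Fin n) :
    KMem B (fun _ x => x j : KOpOfArity A k n) :=
  ⟨j.pos, hB.proj_mem ⟨n, j.pos⟩ j⟩

/-- Membership of the unary operation `w`. -/
def KMem₁ {A : Type*} {k : ℕ} (B : Set (KOp A k)) (w : Fin k → A → A) : Prop :=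
  KMem B (fun i x => w i (x 0) : KOpOfArity A k 1)

theorem KMem₁.comp {A : Type*} {k : ℕ} {B : Set (KOp A k)} (hB : IsKClone B)
    {w : Fin k → A → A} (hw : KMem₁ B w) {n : ℕ} {g : KOpOfArity A k n} (hg : KMem B g) :
    KMem B (fun i x => w i (g i x) : KOpOfArity A k n) :=
  KMem.comp hB hw (g := fun _ => g) fun _ => hg

/-- Membership of the binary operation `W`. -/
def KMem₂ {A : Type*} {k : ℕ} (B : Set (KOp A k)) (W : Fin k → A → A → A) : Prop :=
  KMem B (fun i x => W i (x 0) (x 1) : KOpOfArity A k 2)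

theorem KMem₂.comp {A : Type*} {k : ℕ} {B : Set (KOp A k)} (hB : IsKClone B)
    {W : Fin k → A → A → A} (hW : KMem₂ B W) {n : ℕ} {g h : KOpOfArity A k n} (hg : KMem B g)
    (hh : KMem B h) : KMem B (fun i x => W i (g i x) (h i x) : KOpOfArity A k n) :=
  KMem.comp hB hW (g := ![g, h]) fun j => by fin_cases j; exacts [hg, hh]

/-- Membership of the ternary operation `t`. -/
def KMem₃ {A : Type*} {k : ℕ} (B : Set (KOp A k)) (t : Fin k → A → A → A → A) : Prop :=
  KMem B (fun i x => t i (x 0) (x 1) (x 2) : KOpOfArity A k 3)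

theorem KMem₃.comp {A : Type*} {k : ℕ} {B : Set (KOp A k)} (hB : IsKClone B)
    {t : Fin k → A → A → A → A} (ht : KMem₃ B t) {n : ℕ} {g₁ g₂ g₃ : KOpOfArity A k n}
    (h₁ : KMem B g₁) (h₂ : KMem B g₂) (h₃ : KMem B g₃) :
    KMem B (fun i x => t i (g₁ i x) (g₂ i x) (g₃ i x) : KOpOfArity A k n) :=
  KMem.comp hB ht (g := ![g₁, g₂, g₃]) fun j => by fin_cases j; exacts [h₁, h₂, h₃]

theorem KMem₃.reverse {A : Type*} {k : ℕ} {B : Set (KOp A k)} (hB : IsKClone B)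
    {t : Fin k → A → A → A → A} (ht : KMem₃ B t) : KMem₃ B fun i x y z => t i z y x :=
  KMem₃.comp hB ht (KMem.proj hB 2) (KMem.proj hB 1) (KMem.proj hB 0)

/-! ### Repairing the diagonal by unary operations -/

theorem fin_two_eq {a b c : Fin 2} (hab : a ≠ b) (hcb : c ≠ b) : a = c := by omega

namespace KOpOfArity

variable {k n : ℕ} (f : KOpOfArity (Fin 2) k n)

/-- The component of sort `i` is a constant function. -/
def ConstAt (i : Fin k) : Prop := ∀ x y, f i x = f i y

/-- The unary operation obtained by identifying all variables. -/
def diag (i : Fin k) (a : Fin 2) : Fin 2 := f i fun _ => a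

/-- The component of sort `i` is not constant, but its diagonal is. -/
def Collapsing (i : Fin k) : Prop := ¬f.ConstAt i ∧ f.diag i 0 = f.diag i 1

variable {f} in
theorem Collapsing.diag_eq {i : Fin k} (hi : f.Collapsing i) (a : Fin 2) :
    f.diag i a = f.diag i 0 := by
  fin_cases a
  · rfl
  · exact hi.2.symm

variable {f} in
theorem Collapsing.exists_ne {i : Fin k} (hi : f.Collapsing i) : ∃ x, f i x ≠ f.diag i 0 := by
  by_contra hcon
  push Not at hcon
  exact hi.1 fun x y => (hcon x).trans (hcon y).symm

/-- A unary operation of `B` that agrees with `δ` on the non-constant sorts of `f` whose diagonal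
is not constant, and that is on each collapsing sort either the identity or the constant diagonal
value; moreover it has binary witnesses for each collapsing sort. -/
structure Admissible (B : Set (KOp (Fin 2) k)) (δ w : Fin k → Fin 2 → Fin 2) : Prop where
  mem : KMem₁ B w
  regular : ∀ i, ¬f.ConstAt i → ¬f.Collapsing i → ∀ a, w i a = δ i a
  collapsing : ∀ i, f.Collapsing i → (∀ a, w i a = a) ∨ ∀ a, w i a = f.diag i 0
  witness : ∀ i, f.Collapsing i → ∃ W, KMem₂ B W ∧ (∀ i', ¬f.ConstAt i' → ∀ a, W i' a a = w i' a) ∧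
    ∀ b, b ≠ f.diag i 0 → W i (f.diag i 0) b = b

/-- An admissible operation that agrees with `f` on the sorts where `f` is constant. -/
def Retract (B : Set (KOp (Fin 2) k)) (w : Fin k → Fin 2 → Fin 2) : Prop :=
  f.Admissible B (fun _ a => a) w ∧ ∀ i, f.ConstAt i → ∀ a, w i a = f.diag i 0

variable {f} {B : Set (KOp (Fin 2) k)}

theorem Admissible.apply_base {δ w} (h : f.Admissible B δ w) {i : Fin k} (hi : f.Collapsing i) :
    w i (f.diag i 0) = f.diag i 0 := by
  rcases h.collapsing i hi with h | h <;> exact h _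

theorem admissible_id (hB : IsKClone B) : f.Admissible B (fun _ a => a) (fun _ a => a) where
  mem := KMem.proj hB 0
  regular _ _ _ _ := rfl
  collapsing _ _ := Or.inl fun _ => rfl
  witness _ _ := ⟨fun _ _ b => b, KMem.proj hB 1, fun _ _ _ => rfl, fun _ _ => rfl⟩

/-- The unary operation `f(w₁, …, wₙ)`. -/
def substUnary (f : KOpOfArity (Fin 2) k n) (w : Fin n → Fin k → Fin 2 → Fin 2) (i : Fin k)
    (a : Fin 2) : Fin 2 := f i fun j => w j i a

theorem substUnary_base {w : Fin n → Fin k → Fin 2 → Fin 2}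
    (hw : ∀ j, f.Admissible B (fun _ a => a) (w j)) {i : Fin k} (hi : f.Collapsing i) :
    f.substUnary w i (f.diag i 0) = f.diag i 0 := by
  have : (fun j => w j i (f.diag i 0)) = fun _ => f.diag i 0 :=
    funext fun j => (hw j).apply_base hi
  rw [substUnary, this]
  exact hi.diag_eq _

theorem admissible_substUnary (hB : IsKClone B) (hf : KMem B f)
    {w : Fin n → Fin k → Fin 2 → Fin 2} (hw : ∀ j, f.Admissible B (fun _ a => a) (w j)) :
    f.Admissible B f.diag (f.substUnary w) where
  mem := KMem.comp hB hf fun j => (hw j).mem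
  regular i h1 h2 a := by
    have : (fun j => w j i a) = fun _ => a := funext fun j => (hw j).regular i h1 h2 a
    rw [substUnary, this]
    rfl
  collapsing i hi := by
    have hbase := substUnary_base hw hi
    by_cases hc : ∀ a, f.substUnary w i a = f.diag i 0
    · exact Or.inr hc
    · left
      push Not at hc
      obtain ⟨b, hb⟩ := hc
      intro a
      by_cases ha : a = f.diag i 0
      · rw [ha, hbase]
      · have hb' : b ≠ f.diag i 0 := by rintro rfl; exact hb hbase
        rw [fin_two_eq ha hb']
        exact fin_two_eq hb hb'
  witness i hi := by
    classical
    obtain ⟨x, hx⟩ := hi.exists_ne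
    choose W hW hWd hWi using fun j => (hw j).witness i hi
    -- The point `x` is where `f` leaves its diagonal value. The witnesses `W j` are used exactly
    -- where `x` differs from that value, so that the arguments of `f` at sort `i` become `x`.
    refine ⟨fun i' a b => f i' fun j => if x j = f.diag i 0 then w j i' a else W j i' a b, ?_,
      fun i' hi' a => ?_, fun b hb => ?_⟩
    · refine KMem.comp hB hf (g := fun j i' y => if x j = f.diag i 0 then w j i' (y 0) else
        W j i' (y 0) (y 1)) fun j => ?_
      by_cases h : x j = f.diag i 0
      · simp only [h, if_true]
        exact KMem₁.comp hB (hw j).mem (KMem.proj hB 0)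
      · simp only [h, if_false]
        exact hW j
    · refine congrArg (f i') (funext fun j => ?_)
      split_ifs
      · rfl
      · exact hWd j i' hi' a
    · have : (fun j => if x j = f.diag i 0 then w j i (f.diag i 0) else W j i (f.diag i 0) b) = x := by
        funext j
        split_ifs with h
        · rw [h, (hw j).apply_base hi]
        · rw [hWi j b hb]
          exact fin_two_eq hb h
      exact (congrArg (f i) this).trans (fin_two_eq hx hb)

theorem diag_diag {i : Fin k} (h1 : ¬f.ConstAt i) (h2 : ¬f.Collapsing i) (a : Fin 2) :
    f.diag i (f.diag i a) = a := by
  have h : f.diag i 0 ≠ f.diag i 1 := fun h => h2 ⟨h1, h⟩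
  generalize f.diag i = g at h
  revert g a
  decide

theorem Admissible.comp (hB : IsKClone B) {δ δ' w w'} (h : f.Admissible B δ w)
    (h' : f.Admissible B δ' w') : f.Admissible B (fun i a => δ i (δ' i a))
      (fun i a => w i (w' i a)) where
  mem := KMem₁.comp hB h.mem h'.mem
  regular i h1 h2 a := by rw [h'.regular i h1 h2, h.regular i h1 h2]
  collapsing i hi := by
    rcases h'.collapsing i hi with h1 | h1
    · simpa only [h1] using h.collapsing i hi
    · exact Or.inr fun a => by rw [h1, h.apply_base hi]
  witness i hi := by
    obtain ⟨W, hW, hWd, hWi⟩ := h.witness i hi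
    obtain ⟨W', hW', hWd', hWi'⟩ := h'.witness i hi
    refine ⟨fun i' a b => W i' (w' i' a) (W' i' a b), ?_, fun i' hi' a => ?_, fun b hb => ?_⟩
    · exact KMem₂.comp hB hW (KMem₁.comp hB h'.mem (KMem.proj hB 0)) hW'
    · simp only [hWd' i' hi', hWd i' hi']
    · simp only [hWi' b hb, h'.apply_base hi, hWi b hb]

theorem Admissible.congr {δ δ' w} (h : f.Admissible B δ w)
    (hδ : ∀ i, ¬f.ConstAt i → ¬f.Collapsing i → ∀ a, δ i a = δ' i a) : f.Admissible B δ' w :=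
  ⟨h.mem, fun i h1 h2 a => (h.regular i h1 h2 a).trans (hδ i h1 h2 a), h.collapsing, h.witness⟩

theorem Retract.comp (hB : IsKClone B) {w w'} (h : f.Retract B w) (h' : f.Retract B w') :
    f.Retract B (fun i a => w i (w' i a)) :=
  ⟨h.1.comp hB h'.1, fun i hi _ => h.2 i hi _⟩

theorem substUnary_const {w : Fin n → Fin k → Fin 2 → Fin 2} {i : Fin k} (hi : f.ConstAt i)
    (a : Fin 2) : f.substUnary w i a = f.diag i 0 := hi _ _

/-- On sorts with nonconstant diagonal the substitution is the diagonal, a permutation of two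
values; applying it twice gives the identity. -/
theorem retract_substUnary (hB : IsKClone B) (hf : KMem B f)
    {w : Fin n → Fin k → Fin 2 → Fin 2} (hw : ∀ j, f.Admissible B (fun _ a => a) (w j)) :
    f.Retract B (fun i a => f.substUnary w i (f.substUnary w i a)) :=
  have h := admissible_substUnary hB hf hw
  ⟨(h.comp hB h).congr fun _ h1 h2 => diag_diag h1 h2, fun _ hi _ => substUnary_const hi _⟩

/-- Although `f` has constant diagonal on collapsing sorts, feeding different unary members into its
variables recovers the identity on all of them at once. The proof is by induction on the set of
sorts to be repaired. -/
theorem exists_substUnary_id (hB : IsKClone B) (hf : KMem B f) :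
    ∃ w : Fin n → Fin k → Fin 2 → Fin 2, (∀ j, f.Admissible B (fun _ a => a) (w j)) ∧
      ∀ i, f.Collapsing i → ∀ a, f.substUnary w i a = a := by
  classical
  let S : (Fin k → Fin 2 → Fin 2) → Finset (Fin k) :=
    fun w => Finset.univ.filter fun i => f.Collapsing i ∧ ∀ a, w i a = a
  have hS : ∀ w i, i ∈ S w ↔ f.Collapsing i ∧ ∀ a, w i a = a := fun w i => by simp [S]
  have key : ∀ K' : Finset (Fin k), (∀ i ∈ K', f.Collapsing i) →
      ∃ w : Fin n → Fin k → Fin 2 → Fin 2, (∀ j, f.Admissible B (fun _ a => a) (w j)) ∧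
      ∀ i ∈ K', ∀ a, f.substUnary w i a = a := by
    intro K'
    induction K' using Finset.strongInduction with
    | H K' ih =>
      intro hK'
      -- Composing retracts intersects their identity sets, so one of minimal size is least among
      -- those containing `X`.
      have hmin : ∀ X, X ⊂ K' → ∃ w, f.Retract B w ∧ X ⊆ S w ∧
          ∀ w', f.Retract B w' → X ⊆ S w' → S w ⊆ S w' := by
        intro X hX
        obtain ⟨ws, hws, hid⟩ := ih X hX fun i hi => hK' i (hX.1 hi)
        obtain ⟨w, ⟨hw1, hw2⟩, hw3⟩ := (measure fun w => (S w).card).wf.has_min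
          {w | f.Retract B w ∧ X ⊆ S w} ⟨_, retract_substUnary hB hf hws, fun i hi =>
            (hS _ _).2 ⟨hK' i (hX.1 hi), fun a => by rw [hid i hi, hid i hi]⟩⟩
        refine ⟨w, hw1, hw2, fun w' hw1' hw2' i hi => ?_⟩
        by_contra hi'
        refine hw3 (fun i a => w i (w' i a)) ⟨hw1.comp hB hw1', fun x hx => ?_⟩ ?_
        · have h1 := (hS _ _).1 (hw2 hx)
          have h2 := (hS _ _).1 (hw2' hx)
          exact (hS _ _).2 ⟨h1.1, fun a => by rw [h2.2, h1.2]⟩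
        · refine Finset.card_lt_card ⟨fun x hx => ?_, fun hsub => ?_⟩
          · obtain ⟨h1, h2⟩ := (hS _ _).1 hx
            refine (hS _ _).2 ⟨h1, ?_⟩
            rcases hw1.1.collapsing x h1 with h | h
            · exact h
            · have h3 := (h2 0).symm.trans (h _)
              have h4 := (h2 1).symm.trans (h _)
              exact absurd (h3.trans h4.symm) (by decide)
          · obtain ⟨h1, h2⟩ := (hS _ _).1 (hsub hi)
            obtain ⟨-, h3⟩ := (hS _ _).1 hi
            exact hi' ((hS _ _).2 ⟨h1, fun a => (h3 _).symm.trans (h2 a)⟩)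
      choose! m hm1 hm2 hm3 using hmin
      -- If the least retract over `X` is forced to fix a further sort `i`, a solution for `K'.erase
      -- i` also solves `i`. Otherwise each proper subset of `K'` is exactly the part of `K'` fixed
      -- by its least retract.
      by_cases hA : ∃ X, X ⊂ K' ∧ ∃ i ∈ K', i ∉ X ∧ i ∈ S (m X)
      · obtain ⟨X, hX, i, hi, hiX, him⟩ := hA
        obtain ⟨ws, hws, hid⟩ := ih (K'.erase i) (Finset.erase_ssubset hi)
          fun i' hi' => hK' i' (Finset.mem_of_mem_erase hi')
        refine ⟨ws, hws, fun i' hi' => ?_⟩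
        by_cases hii : i' = i
        · subst hii
          have h1 := hm3 X hX _ (retract_substUnary hB hf hws) (fun x hx => (hS _ _).2
            ⟨hK' x (hX.1 hx), fun a => by
              have : x ∈ K'.erase i' := Finset.mem_erase.2 ⟨fun h => hiX (h ▸ hx), hX.1 hx⟩
              rw [hid x this, hid x this]⟩) him
          have h2 := ((hS _ _).1 h1).2
          have had := admissible_substUnary hB hf hws
          rcases had.collapsing i' (hK' i' hi') with h | h
          · exact h
          · have h3 := (h2 0).symm.trans (h _)
            have h4 := (h2 1).symm.trans (h _)
            exact absurd (h3.trans h4.symm) (by decide)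
        · exact hid i' (Finset.mem_erase.2 ⟨hii, hi'⟩)
      · have hex : ∀ i, f.Collapsing i → ∃ x, f i x ≠ f.diag i 0 := fun i hi => hi.exists_ne
        choose! x hx using hex
        -- With this choice the unary operations send the non-diagonal value at each sort `i` to the
        -- point `x i`.
        let X : Fin n → Finset (Fin k) := fun j => K'.filter fun i => x i j ≠ f.diag i 0
        have hXsub : ∀ j, X j ≠ K' → X j ⊂ K' := fun j hj =>
          (Finset.filter_subset _ _).ssubset_of_ne hj
        refine ⟨fun j => if X j = K' then fun _ a => a else m (X j), fun j => ?_, ?_⟩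
        · dsimp only
          split_ifs with h
          · exact admissible_id hB
          · exact (hm1 _ (hXsub j h)).1
        · intro i hi
          have hic := hK' i hi
          have hws : ∀ j, f.Admissible B (fun _ a => a)
              (if X j = K' then fun _ a => a else m (X j)) := by
            intro j
            split_ifs with h
            · exact admissible_id hB
            · exact (hm1 _ (hXsub j h)).1
          intro a
          by_cases ha : a = f.diag i 0
          · rw [ha]
            exact substUnary_base hws hic
          · have : (fun j => (if X j = K' then fun _ a => a else m (X j)) i a) = x i := by
              funext j
              by_cases hij : x i j = f.diag i 0
              · have hiX : i ∉ X j := by simp [X, hij]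
                have hne : X j ≠ K' := by rintro h; exact hiX (h ▸ hi)
                rw [if_neg hne, hij]
                have hnot : i ∉ S (m (X j)) := fun h => hA ⟨_, hXsub j hne, i, hi, hiX, h⟩
                rcases (hm1 _ (hXsub j hne)).1.collapsing i hic with h | h
                · exact absurd ((hS _ _).2 ⟨hic, h⟩) hnot
                · exact h a
              · rw [← fin_two_eq ha hij]
                split_ifs with h
                · rfl
                · exact ((hS _ _).1 (hm2 _ (hXsub j h) (by simp [X, hi, hij]))).2 a
            exact (congrArg (f i) this).trans (fin_two_eq (hx i hic) ha)
  obtain ⟨w, hw, hid⟩ := key (Finset.univ.filter f.Collapsing) (by simp)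
  exact ⟨w, hw, fun i hi => hid i (by simpa using hi)⟩

variable (f) in
/-- The diagonal is the identity on every sort on which it is not constant. -/
def Normalized : Prop := ∀ i, ¬f.ConstAt i → ¬f.Collapsing i → ∀ a, f.diag i a = a

/-- The repaired diagonal `v` is an involution on every nonconstant sort and equals the value of `f`
on the constant ones. Thus composing with it is reversible, and its square serves as `e`. -/
theorem exists_normalized (hB : IsKClone B) (hf : KMem B f) :
    ∃ v : Fin k → Fin 2 → Fin 2, KMem₁ B v ∧ (∀ i x, v i (v i (f i x)) = f i x) ∧
      ∀ g : KOpOfArity (Fin 2) k n, (g = fun i x => v i (f i x)) → g.Normalized ∧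
        ∃ e : Fin k → Fin 2 → Fin 2, KMem₁ B e ∧ (∀ i, ¬g.ConstAt i → ∀ a, e i a = a) ∧
          ∀ i, g.ConstAt i → ∀ a x, e i a = g i x := by
  obtain ⟨w, hw, hid⟩ := exists_substUnary_id hB hf
  have had := admissible_substUnary hB hf hw
  have hc : ∀ i, f.ConstAt i → ∀ a, f.substUnary w i a = f.diag i 0 := fun i hi =>
    substUnary_const hi
  have hinv : ∀ i, ¬f.ConstAt i → ∀ a, f.substUnary w i (f.substUnary w i a) = a := by
    intro i hi a
    by_cases hcol : f.Collapsing i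
    · rw [hid i hcol, hid i hcol]
    · rw [had.regular i hi hcol, had.regular i hi hcol]
      exact diag_diag hi hcol a
  refine ⟨f.substUnary w, had.mem, fun i x => ?_, ?_⟩
  · by_cases hi : f.ConstAt i
    · rw [hc i hi]; exact hi _ _
    · exact hinv i hi _
  · rintro g rfl
    have hcg : ∀ i, ConstAt (fun i x => f.substUnary w i (f i x)) i → f.ConstAt i := by
      intro i hi
      by_contra hfi
      refine hfi fun x y => ?_
      rw [← hinv i hfi (f i x), ← hinv i hfi (f i y)]
      exact congrArg _ (hi x y)
    refine ⟨fun i h1 h2 a => ?_, fun i a => f.substUnary w i (f.substUnary w i a),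
      KMem₁.comp hB had.mem had.mem, fun i hi a => ?_, fun i hi a x => ?_⟩
    · have hfi : ¬f.ConstAt i := fun h => h1 fun x y => congrArg _ (h x y)
      have hfc : ¬f.Collapsing i := fun h => h2 ⟨h1, congrArg (f.substUnary w i) h.2⟩
      exact (had.regular i hfi hfc _).trans (diag_diag hfi hfc a)
    · exact hinv i (fun h => hi fun x y => congrArg _ (h x y)) a
    · have hfi := hcg i hi
      simp only [hc i hfi]

/-- This links a single operation to the fault system: failure of monotonicity in one sort shows up
in a ternary operation idempotent on all nonconstant sorts. -/
theorem exists_nonmonotone_idempotent (hB : IsKClone B) (hf : KMem B f) (hn : f.Normalized)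
    {i : Fin k} (hi : ¬f.ConstAt i) (hmono : ¬Monotone (f i)) :
    ∃ t : Fin k → Fin 2 → Fin 2 → Fin 2 → Fin 2, KMem₃ B t ∧
      (∀ i', ¬f.ConstAt i' → ∀ a, t i' a a a = a) ∧ t i 1 0 0 = 1 ∧ t i 1 1 0 = 0 := by
  classical
  obtain ⟨w, hw, hid⟩ := exists_substUnary_id hB hf
  have had := admissible_substUnary hB hf hw
  have hv : ∀ i', ¬f.ConstAt i' → ∀ a, f.substUnary w i' a = a := by
    intro i' hi' a
    by_cases hcol : f.Collapsing i'
    · exact hid i' hcol a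
    · rw [had.regular i' hi' hcol, hn i' hi' hcol]
  by_cases hcol : f.Collapsing i
  · choose W hW hWd hWi using fun j => (hw j).witness i hcol
    -- On a collapsing sort with diagonal value `c`, taking `x = y = c` gives the repaired identity
    -- in `z`, while `y = z ≠ c` puts `z` in every argument and collapses to `c`.
    let t : Fin k → Fin 2 → Fin 2 → Fin 2 → Fin 2 := fun i' x y z =>
      f i' fun j => if ∀ a, w j i a = a then w j i' z else W j i' x y
    have ht : KMem₃ B t := by
      refine KMem.comp hB hf (g := fun j i' x => if ∀ a, w j i a = a then w j i' (x 2) else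
        W j i' (x 0) (x 1)) fun j => ?_
      by_cases h : ∀ a, w j i a = a
      · simp only [h, implies_true, if_true]
        exact KMem₁.comp hB (hw j).mem (KMem.proj hB 2)
      · simp only [h, if_false]
        exact KMem₂.comp hB (hW j) (KMem.proj hB 0) (KMem.proj hB 1)
    have htd : ∀ i', ¬f.ConstAt i' → ∀ a, t i' a a a = a := by
      intro i' hi' a
      refine Eq.trans (congrArg (f i') (funext fun j => ?_)) (hv i' hi' a)
      split_ifs
      · rfl
      · exact hWd j i' hi' a
    have h1 : ∀ b, b ≠ f.diag i 0 → t i (f.diag i 0) (f.diag i 0) b = b := by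
      intro b _
      refine Eq.trans (congrArg (f i) (funext fun j => ?_)) (hv i hi b)
      split_ifs with h
      · rfl
      · have h' := ((hw j).collapsing i hcol).resolve_left h
        rw [hWd j i hi, h', h']
    have h2 : ∀ b, b ≠ f.diag i 0 → t i (f.diag i 0) b b = f.diag i 0 := by
      intro b hb
      refine Eq.trans (congrArg (f i) (funext fun j => ?_)) (hcol.diag_eq b)
      split_ifs with h
      · exact h b
      · exact hWi j b hb
    have hc : f.diag i 0 = 0 ∨ f.diag i 0 = 1 := by omega
    rcases hc with hc | hc
    · rw [hc] at h1 h2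
      exact ⟨_, ht.reverse hB, htd, h1 1 (by decide), h2 1 (by decide)⟩
    · rw [hc] at h1 h2
      exact ⟨t, ht, htd, h2 0 (by decide), h1 0 (by decide)⟩
  · obtain ⟨p, p', hpp, hlt⟩ : ∃ p p', p ≤ p' ∧ ¬f i p ≤ f i p' := by
      simpa [Monotone] using hmono
    -- The variables are grouped by a failure `p ≤ p'` of monotonicity: `x` where `p` is 1, `y`
    -- where only `p'` is, `z` elsewhere.
    refine ⟨fun i' x y z => f i' fun j => w j i' (if p j = 1 then x else if p' j = 1 then y else z),
      ?_, fun i' hi' a => ?_, ?_, ?_⟩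
    · refine KMem.comp hB hf (g := fun j i' x => w j i' (if p j = 1 then x 0 else
        if p' j = 1 then x 1 else x 2)) fun j => KMem₁.comp hB (hw j).mem ?_
      split_ifs
      exacts [KMem.proj hB 0, KMem.proj hB 1, KMem.proj hB 2]
    · simp only [ite_self]
      exact hv i' hi' a
    · have : (fun j => w j i (if p j = 1 then 1 else if p' j = 1 then 0 else 0)) = p := by
        funext j
        rw [(hw j).regular i hi hcol, ite_self]
        have h01 : p j = 0 ∨ p j = 1 := by omega
        rcases h01 with h | h <;> simp [h]
      refine (congrArg (f i) this).trans ?_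
      show f i p = 1
      omega
    · have : (fun j => w j i (if p j = 1 then 1 else if p' j = 1 then 1 else 0)) = p' := by
        funext j
        have hle := hpp j
        rw [(hw j).regular i hi hcol]
        have h01 : p j = 0 ∨ p j = 1 := by omega
        have h01' : p' j = 0 ∨ p' j = 1 := by omega
        rcases h01 with h | h <;> rcases h01' with h' | h' <;> simp [h, h'] at hle ⊢
      refine (congrArg (f i) this).trans ?_
      show f i p' = 0
      omega

end KOpOfArity

/-! ### Parity relations separating an operation from a clone -/

/-- The set of coordinates in which `x` differs from `b`. -/
def faults {Q : Type*} [Fintype Q] (b x : Q → Fin 2) : Finset Q :=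
  Finset.univ.filter fun q => x q ≠ b q

theorem mem_faults {Q : Type*} [Fintype Q] {b x : Q → Fin 2} {q : Q} :
    q ∈ faults b x ↔ x q ≠ b q := by simp [faults]

/-- The relation: some fault lies outside `L`, or the number of faults is odd. -/
def ParityRel {Q : Type*} (L P : Finset Q) : Prop := P ⊆ L → Odd P.card

/-- The operation `f` does not preserve the parity relation given by the sorts `s`, the base
point `b` and the set `L`. -/
def Violates {k n : ℕ} {Q : Type*} [Fintype Q] (f : KOpOfArity (Fin 2) k n) (s : Q → Fin k)
    (b : Q → Fin 2) (L : Finset Q) : Prop :=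
  ∃ y : Fin n → Q → Fin 2, (∀ j, ParityRel L (faults b (y j))) ∧
    ¬ParityRel L (faults b fun q => f (s q) fun j => y j q)

/-- The coordinate `a` of a pattern, flipped if `x` holds. -/
def flipIf (x : Bool) (a : Fin 2) : Fin 2 := if x then a + 1 else a

/-- The relation is read off from the fault system on a minimal separating set. The projections
satisfy it, but `f` applied to them has no fault. -/
theorem exists_violation {k n : ℕ} {B : Set (KOp (Fin 2) k)} (hB : IsKClone B)
    (f : KOpOfArity (Fin 2) k n) (hf : ¬KMem B f) {e : Fin k → Fin 2 → Fin 2} (he : KMem₁ B e)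
    (he₁ : ∀ i, ¬f.ConstAt i → ∀ a, e i a = a) (he₂ : ∀ i, f.ConstAt i → ∀ a x, e i a = f i x) :
    ∃ (Q : Type) (_ : Fintype Q) (s : Q → Fin k) (b : Q → Fin 2) (L : Finset Q),
      (∀ q, ¬f.ConstAt (s q)) ∧ Violates f s b L ∧
      ∀ (m : ℕ) (h : KOpOfArity (Fin 2) k m), KMem B h → h.Normalized →
        (∀ i, h.ConstAt i ↔ f.ConstAt i) → ¬Violates h s b L := by
  classical
  let Pt := Fin k × (Fin n → Fin 2)
  let Sep : Finset Pt → Prop := fun Q => ∀ g : KOpOfArity (Fin 2) k n, KMem B g →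
    ∃ q ∈ Q, g q.1 q.2 ≠ f q.1 q.2
  obtain ⟨Q, hQ, hmin⟩ := (measure fun Q : Finset Pt => Q.card).wf.has_min {Q | Sep Q}
    ⟨Finset.univ, fun g hg => by
      by_contra hcon
      push Not at hcon
      refine hf ?_
      rwa [show f = g from funext fun i => funext fun x => (hcon (i, x) (Finset.mem_univ _)).symm]⟩
  have hmin' : ∀ q ∈ Q, ∃ g : KOpOfArity (Fin 2) k n, KMem B g ∧
      ∀ q' ∈ Q, (g q'.1 q'.2 ≠ f q'.1 q'.2 ↔ q' = q) := by
    intro q hq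
    have : ¬Sep (Q.erase q) := fun h => hmin _ h (Finset.card_erase_lt_of_mem hq)
    simp only [Sep] at this
    push Not at this
    obtain ⟨g, hg, hgq⟩ := this
    refine ⟨g, hg, fun q' hq' => ⟨fun h => ?_, ?_⟩⟩
    · by_contra hne
      exact h (hgq q' (Finset.mem_erase.2 ⟨hne, hq'⟩))
    · rintro rfl
      obtain ⟨p, hp, hpne⟩ := hQ g hg
      by_cases hpq : p = q'
      · exact hpq ▸ hpne
      · exact absurd (hgq p (Finset.mem_erase.2 ⟨hpq, hp⟩)) hpne
  -- Composing with `e` repairs all faults in constant sorts and creates none elsewhere, so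
  -- minimality leaves no such points.
  have hsort : ∀ q ∈ Q, ¬f.ConstAt q.1 := by
    intro q hq hc
    obtain ⟨g, hg, hgq⟩ := hmin' q hq
    obtain ⟨p, hp, hpne⟩ := hQ _ (KMem₁.comp hB he hg)
    by_cases hpc : f.ConstAt p.1
    · exact hpne (he₂ _ hpc _ _)
    · rw [he₁ _ hpc] at hpne
      have := (hgq p hp).1 hpne
      exact hpc (this ▸ hc)
  let s : Q → Fin k := fun q => q.1.1
  let b : Q → Fin 2 := fun q => f q.1.1 q.1.2
  let ev : KOpOfArity (Fin 2) k n → Q → Fin 2 := fun g q => g q.1.1 q.1.2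
  let F : Set (Finset Q) := {P | ∃ g, KMem B g ∧ faults b (ev g) = P}
  let T : Set (Q → Bool → Bool → Bool → Bool) := {d | ∃ t, KMem₃ B t ∧
    (∀ i, ¬f.ConstAt i → ∀ a, t i a a a = a) ∧
    d = fun q x y z => decide (t (s q) (flipIf x (b q)) (flipIf y (b q)) (flipIf z (b q)) ≠ b q)}
  have hflip : ∀ x a, decide (flipIf x a ≠ a) = x := by decide
  have hflip' : ∀ a c : Fin 2, flipIf (decide (c ≠ a)) a = c := by decide
  have hev : ∀ g q, flipIf (decide (q ∈ faults b (ev g))) (b q) = g q.1.1 q.1.2 := by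
    intro g q
    simp only [mem_faults]
    exact hflip' _ _
  have hsys : FaultSystem T F := by
    refine ⟨?_, ?_, ?_, ?_, ?_⟩
    · rintro _ ⟨t, -, ht, rfl⟩ q x
      have := ht (s q) (hsort _ q.2)
      simp only [this]
      exact hflip _ _
    · rintro _ ⟨t, ht, hti, rfl⟩
      exact ⟨_, ht.reverse hB, hti, rfl⟩
    · rintro _ ⟨t, ht, hti, rfl⟩ _ ⟨g₁, hg₁, rfl⟩ _ ⟨g₂, hg₂, rfl⟩ _ ⟨g₃, hg₃, rfl⟩
      refine ⟨_, KMem₃.comp hB ht hg₁ hg₂ hg₃, ?_⟩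
      ext q
      simp only [hev, Finset.mem_filter, Finset.mem_univ, true_and, decide_eq_true_eq]
      rw [mem_faults]
    · rintro ⟨g, hg, hge⟩
      obtain ⟨q, hq, hqne⟩ := hQ g hg
      have : (⟨q, hq⟩ : Q) ∈ faults b (ev g) := mem_faults.2 hqne
      rw [hge] at this
      simp at this
    · intro q
      obtain ⟨g, hg, hgq⟩ := hmin' q.1 q.2
      refine ⟨g, hg, ?_⟩
      ext q'
      rw [mem_faults, Finset.mem_singleton, Subtype.ext_iff]
      exact hgq q'.1 q'.2
  obtain ⟨L, hLN, hL, hout⟩ := hsys.exists_parity_set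
  have hF : ∀ P ∈ F, ParityRel L P := fun P hP hPL => (hL P hPL).1 hP
  refine ⟨Q, inferInstance, s, b, L, fun q => hsort _ q.2, ?_, ?_⟩
  · refine ⟨fun j q => q.1.2 j, fun j => hF _ ⟨_, KMem.proj hB j, rfl⟩, fun h => ?_⟩
    have h0 : faults b (fun q : Q => f (s q) fun j => q.1.2 j) = ∅ := by
      ext q; simp [mem_faults, s, b]
    rw [h0] at h
    simpa using h (Finset.empty_subset _)
  · rintro m h hh hnorm hconst ⟨y, hy, hviol⟩
    have hmono : ∀ q, ¬FaultSystem.NonMono T q → Monotone (h (s q)) := by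
      intro q hq
      by_contra hm
      obtain ⟨t, ht, hti, h1, h2⟩ := KOpOfArity.exists_nonmonotone_idempotent hB hh hnorm
        (fun hc => hsort _ q.2 ((hconst _).1 hc)) hm
      change t (s q) 1 0 0 = 1 at h1
      change t (s q) 1 1 0 = 0 at h2
      have hti' : ∀ i, ¬f.ConstAt i → ∀ a, t i a a a = a :=
        fun i hi => hti i fun hc => hi ((hconst i).1 hc)
      have hb : b q = 0 ∨ b q = 1 := by omega
      rcases hb with hb | hb
      · refine hq ⟨_, ⟨_, ht.reverse hB, hti', rfl⟩, ?_, ?_⟩ <;> simp [hb, flipIf, h1, h2]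
      · refine hq ⟨_, ⟨_, ht, hti', rfl⟩, ?_, ?_⟩ <;> simp [hb, flipIf, h1, h2]
    -- Faults at monotone coordinates may be dropped, except one fault outside `L` kept to certify
    -- membership.
    have hrow : ∀ j, ∃ g : KOpOfArity (Fin 2) k n, KMem B g ∧
        faults b (ev g) ⊆ faults b (y j) ∧
        ∀ q, FaultSystem.NonMono T q → (q ∈ faults b (ev g) ↔ q ∈ faults b (y j)) := by
      intro j
      suffices hP : ∃ P ∈ F, P ⊆ faults b (y j) ∧
          ∀ q, FaultSystem.NonMono T q → (q ∈ P ↔ q ∈ faults b (y j)) by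
        obtain ⟨_, ⟨g, hg, rfl⟩, h1, h2⟩ := hP
        exact ⟨g, hg, h1, h2⟩
      by_cases hPL : faults b (y j) ⊆ L
      · exact ⟨_, (hL _ hPL).2 (hy j hPL), subset_rfl, fun _ _ => Iff.rfl⟩
      · obtain ⟨p, hp, hpL⟩ := Finset.not_subset.1 hPL
        refine ⟨(faults b (y j)).filter fun q => FaultSystem.NonMono T q ∨ q = p,
          hout _ (fun h => hpL (h (Finset.mem_filter.2 ⟨hp, Or.inr rfl⟩))) ?_,
          Finset.filter_subset _ _, fun q hq => by simp [hq]⟩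
        intro q hq q' hq' h1 h2
        rw [((Finset.mem_filter.1 hq).2.resolve_left h1),
          ((Finset.mem_filter.1 hq').2.resolve_left h2)]
    choose g hg hsub hN using hrow
    have hout' : KMem B (fun i x => h i fun j => g j i x : KOpOfArity (Fin 2) k n) :=
      KMem.comp hB hh hg
    -- The rows are unchanged at non-monotone coordinates. At the others they only move towards the
    -- base point, where the output was already correct, so monotonicity keeps it correct.
    have heq : faults b (ev fun i x => h i fun j => g j i x) =
        faults b fun q => h (s q) fun j => y j q := by
      have hviolL : (faults b fun q => h (s q) fun j => y j q) ⊆ L := by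
        by_contra hcon
        exact hviol fun hsub' => absurd hsub' hcon
      have hsame : ∀ q, FaultSystem.NonMono T q → ∀ j, g j q.1.1 q.1.2 = y j q := by
        intro q hq j
        have := hN j q hq
        simp only [mem_faults, ev] at this
        omega
      ext q
      by_cases hq : FaultSystem.NonMono T q
      · simp only [mem_faults, ev, hsame q hq, s]
      · have hq' : q ∉ faults b fun q => h (s q) fun j => y j q := fun hmem =>
          hq (hLN q (hviolL hmem))
        refine iff_of_false (fun hmem => ?_) hq'
        have hm := hmono q hq
        have hrow : ∀ j, g j q.1.1 q.1.2 ≠ b q → y j q ≠ b q := fun j hj =>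
          mem_faults.1 (hsub j (mem_faults.2 hj))
        rw [mem_faults, not_not] at hq'
        rw [mem_faults] at hmem
        have hb : b q = 0 ∨ b q = 1 := by omega
        rcases hb with hb | hb
        · have : (fun j => g j q.1.1 q.1.2) ≤ fun j => y j q := by
            intro j
            have := hrow j
            show g j q.1.1 q.1.2 ≤ y j q
            omega
          have := hm this
          simp only [ev, s] at *
          omega
        · have : (fun j => y j q) ≤ fun j => g j q.1.1 q.1.2 := by
            intro j
            have := hrow j
            show y j q ≤ g j q.1.1 q.1.2
            omega
          have := hm this
          simp only [ev, s] at *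
          omega
    exact hviol (heq ▸ hF _ ⟨_, hout', rfl⟩)

/-! ### Colour counts and transfer of violations -/

/-- The sort, the value of the base point, and whether the coordinate belongs to `L`. -/
def colour {k : ℕ} {Q : Type*} (s : Q → Fin k) (b : Q → Fin 2) (L : Finset Q) (q : Q) :
    Fin k × Fin 2 × Prop := (s q, b q, q ∈ L)

/-- The number of coordinates of each colour. -/
noncomputable def colourCount {k : ℕ} {Q : Type*} (s : Q → Fin k) (b : Q → Fin 2) (L : Finset Q)
    (γ : Fin k × Fin 2 × Prop) : ℕ := Nat.card {q // colour s b L q = γ}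

theorem exists_embedding_of_fiber_card_le {Q Q' Γ : Type*} [Finite Q] [Finite Q'] {c : Q → Γ}
    {c' : Q' → Γ} (h : ∀ γ, Nat.card {q // c q = γ} ≤ Nat.card {q // c' q = γ}) :
    ∃ ι : Q ↪ Q', ∀ q, c' (ι q) = c q := by
  classical
  have := Fintype.ofFinite Q
  have := Fintype.ofFinite Q'
  have he : ∀ γ, Nonempty ({q // c q = γ} ↪ {q // c' q = γ}) := fun γ =>
    Function.Embedding.nonempty_of_card_le (by simpa only [Nat.card_eq_fintype_card] using h γ)
  let e : ∀ γ, {q // c q = γ} ↪ {q // c' q = γ} := fun γ => (he γ).some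
  exact ⟨(Equiv.sigmaFiberEquiv c).symm.toEmbedding.trans
    (((Function.Embedding.refl Γ).sigmaMap e).trans (Equiv.sigmaFiberEquiv c').toEmbedding),
    fun q => (e (c q) ⟨q, rfl⟩).2⟩

open Classical in
theorem card_filter_comp_eq_sum {Q Γ : Type*} [Fintype Q] [Fintype Γ] (c : Q → Γ) (W : Γ → Prop) :
    (Finset.univ.filter fun q => W (c q)).card =
      ∑ γ ∈ Finset.univ.filter W, Nat.card {q // c q = γ} := by
  rw [Finset.card_eq_sum_card_fiberwise (f := c) (t := Finset.univ.filter W)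
    (by intro q hq; simpa using hq)]
  refine Finset.sum_congr rfl fun γ hγ => ?_
  rw [Nat.card_eq_fintype_card, Fintype.card_subtype, Finset.filter_filter]
  congr 1
  ext q
  simp only [Finset.mem_filter, Finset.mem_univ, true_and] at hγ ⊢
  exact ⟨fun h => h.2, fun h => ⟨h ▸ hγ, h⟩⟩

open Classical in
theorem even_card_filter_notMem_range {Q Q' Γ : Type*} [Fintype Q] [Fintype Q'] [Fintype Γ]
    {c : Q → Γ} {c' : Q' → Γ}
    (h : ∀ γ, Nat.card {q // c q = γ} % 2 = Nat.card {q // c' q = γ} % 2)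
    (ι : Q ↪ Q') (hι : ∀ q, c' (ι q) = c q) (W : Γ → Prop) :
    Even (Finset.univ.filter fun q' => q' ∉ Set.range ι ∧ W (c' q')).card := by
  have h1 : (Finset.univ.filter fun q => W (c q)).card % 2 =
      (Finset.univ.filter fun q' => W (c' q')).card % 2 := by
    rw [card_filter_comp_eq_sum, card_filter_comp_eq_sum, Finset.sum_nat_mod]
    conv_rhs => rw [Finset.sum_nat_mod]
    simp only [h]
  have h2 : (Finset.univ.filter fun q' => W (c' q')) =
      ((Finset.univ.filter fun q => W (c q)).map ι).disjUnion
        (Finset.univ.filter fun q' => q' ∉ Set.range ι ∧ W (c' q')) (by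
          rw [Finset.disjoint_left]
          intro q' h1 h2
          obtain ⟨q, -, rfl⟩ := Finset.mem_map.1 h1
          exact (Finset.mem_filter.1 h2).2.1 ⟨q, rfl⟩) := by
    ext q'
    simp only [Finset.mem_disjUnion, Finset.mem_map, Finset.mem_filter, Finset.mem_univ, true_and]
    constructor
    · intro hW
      by_cases hq : q' ∈ Set.range ι
      · obtain ⟨q, rfl⟩ := hq
        exact Or.inl ⟨q, by rwa [← hι], rfl⟩
      · exact Or.inr ⟨hq, hW⟩
    · rintro (⟨q, hq, rfl⟩ | hq)
      · rwa [hι]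
      · exact hq.2
  rw [h2, Finset.card_disjUnion, Finset.card_map] at h1
  rw [Nat.even_iff]
  omega

-- The rows are padded, on coordinates outside the embedded copy of `Q`, by patterns depending only
-- on colour. Each colour occurs there evenly often, so parities of row faults persist; the output
-- has no fault on the padding.
open Classical in
theorem Violates.lift {k n : ℕ} {Q Q' : Type*} [Fintype Q] [Fintype Q']
    {f : KOpOfArity (Fin 2) k n} {s : Q → Fin k} {b : Q → Fin 2} {L : Finset Q}
    {s' : Q' → Fin k} {b' : Q' → Fin 2} {L' : Finset Q'} (hv : Violates f s b L)
    (hle : colourCount s b L ≤ colourCount s' b' L')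
    (hpar : ∀ γ, colourCount s b L γ % 2 = colourCount s' b' L' γ % 2)
    (hs : ∀ q, ¬f.ConstAt (s' q)) : Violates f s' b' L' := by
  obtain ⟨y, hy, hviol⟩ := hv
  obtain ⟨ι, hι⟩ := exists_embedding_of_fiber_card_le hle
  have hιs : ∀ q, s' (ι q) = s q := fun q => congrArg Prod.fst (hι q)
  have hιb : ∀ q, b' (ι q) = b q := fun q => congrArg (fun γ => γ.2.1) (hι q)
  have hιL : ∀ q, ι q ∈ L' ↔ q ∈ L := fun q => iff_of_eq (congrArg (fun γ => γ.2.2) (hι q))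
  -- A nonconstant component takes both values, hence also the base value.
  have ha : ∀ γ : Fin k × Fin 2 × Prop, ∃ x, ¬f.ConstAt γ.1 → f γ.1 x = γ.2.1 := by
    intro γ
    by_contra! hcon
    refine (hcon 0).1 fun x x' => ?_
    exact fin_two_eq (hcon x).2 (hcon x').2
  choose a ha using ha
  let y' : Fin n → Q' → Fin 2 := fun j =>
    Function.extend ι (y j) fun q' => a (colour s' b' L' q') j
  have hin : ∀ j q, y' j (ι q) = y j q := fun j q => ι.injective.extend_apply _ _ _
  have hext : ∀ j q', q' ∉ Set.range ι → y' j q' = a (colour s' b' L' q') j :=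
    fun j q' hq' => Function.extend_apply' _ _ _ hq'
  refine ⟨y', fun j hsub => ?_, fun h => hviol fun hsub => ?_⟩
  · obtain ⟨W, hW⟩ : ∃ W : Fin k × Fin 2 × Prop → Prop, ∀ γ, W γ ↔ a γ j ≠ γ.2.1 :=
      ⟨_, fun _ => Iff.rfl⟩
    have hcard : faults b' (y' j) = ((faults b (y j)).map ι).disjUnion
        (Finset.univ.filter fun q' => q' ∉ Set.range ι ∧ W (colour s' b' L' q')) (by
          rw [Finset.disjoint_left]
          intro q' h1 h2
          obtain ⟨q, -, rfl⟩ := Finset.mem_map.1 h1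
          exact (Finset.mem_filter.1 h2).2.1 ⟨q, rfl⟩) := by
      ext q'
      simp only [Finset.mem_disjUnion, Finset.mem_map, Finset.mem_filter, Finset.mem_univ,
        true_and, mem_faults, hW]
      by_cases hq : q' ∈ Set.range ι
      · obtain ⟨q, rfl⟩ := hq
        simp [hin, hιb]
      · rw [hext j q' hq]
        constructor
        · exact fun h => Or.inr ⟨hq, h⟩
        · rintro (⟨q, -, rfl⟩ | h)
          exacts [absurd ⟨q, rfl⟩ hq, h.2]
    have hodd := hy j fun q hq => (hιL q).1 (hsub (mem_faults.2 (by
      rw [hin, hιb]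
      exact mem_faults.1 hq)))
    rw [hcard, Finset.card_disjUnion, Finset.card_map]
    exact hodd.add_even (even_card_filter_notMem_range hpar ι hι W)
  · have hout : (faults b' fun q => f (s' q) fun j => y' j q) =
        (faults b fun q => f (s q) fun j => y j q).map ι := by
      ext q'
      rw [mem_faults]
      by_cases hq : q' ∈ Set.range ι
      · obtain ⟨q, rfl⟩ := hq
        simp [hin, hιb, hιs, mem_faults]
      · simp only [hext _ q' hq, Finset.mem_map]
        refine iff_of_false (fun h => h (ha (colour s' b' L' q') (hs q'))) ?_
        rintro ⟨q, -, rfl⟩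
        exact hq ⟨q, rfl⟩
    rw [hout, ParityRel, Finset.card_map] at h
    refine h fun q' hq' => ?_
    obtain ⟨q, hq, rfl⟩ := Finset.mem_map.1 hq'
    exact (hιL q).2 (hsub hq)

/-- Dickson's lemma, combined with the pigeonhole principle for `σ` and the residues. -/
theorem exists_lt_same_residue_le {S Γ : Type*} [Finite S] [Finite Γ] (σ : ℕ → S)
    (c : ℕ → Γ → ℕ) : ∃ m n, m < n ∧ σ m = σ n ∧ c m ≤ c n ∧ ∀ γ, c m γ % 2 = c n γ % 2 := by
  have h1 : WellQuasiOrdered (@Eq (S × (Γ → Fin 2))) := Finite.wellQuasiOrdered _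
  have h2 : WellQuasiOrdered fun a b : Γ → ℕ => a ≤ b := wellQuasiOrdered_le
  obtain ⟨m, n, hmn, he, hle⟩ := h1.prod h2 fun n => ((σ n, fun γ => Fin.ofNat 2 (c n γ)), c n)
  simp only [Prod.mk.injEq] at he
  exact ⟨m, n, hmn, he.1, hle, fun γ => congrArg Fin.val (congrFun he.2 γ)⟩

/-! ### Finite generation and the chain condition -/

/-- Normalized members of `C`, together with the colour counts of some parity relation which they
do not preserve. -/
def IsWitness {k : ℕ} (C : Set (KOp (Fin 2) k))
    (x : KOp (Fin 2) k × (Fin k × Fin 2 × Prop → ℕ)) : Prop :=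
  x.1 ∈ C ∧ x.1.2.Normalized ∧ ∃ (Q : Type) (_ : Fintype Q) (s : Q → Fin k) (b : Q → Fin 2)
    (L : Finset Q), (∀ q, ¬x.1.2.ConstAt (s q)) ∧ colourCount s b L = x.2 ∧ Violates x.1.2 s b L

/-- The inductive step of the infinite sequence. Equality of unary parts puts `v` and `e` in `B`, so
normalization neither enters `B` nor prevents separation. -/
theorem exists_isWitness {k : ℕ} {B C : Set (KOp (Fin 2) k)} (hB : IsKClone B) (hC : IsKClone C)
    (hBC : B ⊂ C) (h₁ : ∀ v, KMem₁ C v → KMem₁ B v)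
    (s : Finset (KOp (Fin 2) k × (Fin k × Fin 2 × Prop → ℕ))) (hs : ∀ x ∈ s, IsWitness C x)
    (hsB : ∀ x ∈ s, x.1 ∈ B) :
    ∃ y, IsWitness C y ∧ ∀ x ∈ s, ¬((∀ i, x.1.2.ConstAt i ↔ y.1.2.ConstAt i) ∧ x.2 ≤ y.2 ∧
      ∀ γ, x.2 γ % 2 = y.2 γ % 2) := by
  obtain ⟨⟨n, f₀⟩, hf₀C, hf₀B⟩ := Set.exists_of_ssubset hBC
  have hf₀ : KMem C f₀ := ⟨n.pos, hf₀C⟩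
  obtain ⟨v, hv, hvv, hnorm⟩ := KOpOfArity.exists_normalized hC hf₀
  obtain ⟨hnorm, e, he, he₁, he₂⟩ := hnorm _ rfl
  have hf : ¬KMem B (fun i x => v i (f₀ i x) : KOpOfArity (Fin 2) k n) := by
    intro h
    have h' : KMem B (fun i x => v i (v i (f₀ i x)) : KOpOfArity (Fin 2) k n) :=
      KMem₁.comp hB (h₁ v hv) h
    rw [show (fun i x => v i (v i (f₀ i x))) = f₀ from funext fun i => funext (hvv i)] at h'
    exact hf₀B h'.2
  obtain ⟨Q, _, t, b, L, ht, hviol, hpres⟩ := exists_violation hB _ hf (h₁ e he) he₁ he₂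
  refine ⟨(⟨n, fun i x => v i (f₀ i x)⟩, colourCount t b L),
    ⟨(KMem₁.comp hC hv hf₀).2, hnorm, Q, _, t, b, L, ht, rfl, hviol⟩, ?_⟩
  rintro x hx ⟨hconst, hle, hpar⟩
  obtain ⟨-, hxn, Q', _, t', b', L', -, hcount, hxv⟩ := hs x hx
  rw [← hcount] at hle hpar
  exact hpres _ x.1.2 ⟨x.1.1.2, hsB x hx⟩ hxn hconst
    (hxv.lift hle hpar fun q hq => ht q ((hconst _).1 hq))

theorem IsKClone.isFinitelyGenerated {k : ℕ} {C : Set (KOp (Fin 2) k)} (hC : IsKClone C) :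
    IsFinitelyGeneratedKClone C := by
  classical
  by_contra hfg
  obtain ⟨x, hx, hbad⟩ := exists_seq_of_forall_finset_exists (IsWitness C)
    (fun x y => ¬((∀ i, x.1.2.ConstAt i ↔ y.1.2.ConstAt i) ∧ x.2 ≤ y.2 ∧
      ∀ γ, x.2 γ % 2 = y.2 γ % 2)) (by
    intro s hs
    let E : Set (KOp (Fin 2) k) := C ∩ Set.range fun g : KOpOfArity (Fin 2) k 1 => ⟨1, g⟩
    -- There are only finitely many unary operations, so all those of `C` can be put among the
    -- generators.
    let F : Set (KOp (Fin 2) k) := E ∪ ↑(s.image Prod.fst)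
    have hF : F.Finite :=
      ((Set.finite_range _).subset Set.inter_subset_right).union (Finset.finite_toSet _)
    have hFC : F ⊆ C := by
      rintro _ (h | h)
      · exact h.1
      · obtain ⟨x, hx, rfl⟩ := Finset.mem_image.1 h
        exact (hs x hx).1
    obtain ⟨⟨hB, hFB⟩, hleast⟩ := kClo_isLeast F
    have hBC : kClo F ⊂ C := (hleast ⟨hC, hFC⟩).ssubset_of_ne fun h => hfg ⟨F, hF, h⟩
    refine exists_isWitness hB hC hBC (fun v hv => ⟨one_pos, hFB (Or.inl ⟨hv.2, _, rfl⟩)⟩) s hs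
      fun x hx => hFB (Or.inr (Finset.mem_coe.2 (Finset.mem_image_of_mem _ hx))))
  obtain ⟨m, n, hmn, hσ, hle, hpar⟩ := exists_lt_same_residue_le
    (fun n => {i | (x n).1.2.ConstAt i}) fun n => (x n).2
  exact hbad m n hmn ⟨fun i => Set.ext_iff.1 hσ i, hle, hpar⟩

theorem IsKClone.iUnion_of_monotone {A : Type*} {k : ℕ} {C : ℕ → Set (KOp A k)}
    (hC : ∀ n, IsKClone (C n)) (hmono : Monotone C) : IsKClone (⋃ n, C n) where
  proj_mem n i := Set.mem_iUnion.2 ⟨0, (hC 0).proj_mem n i⟩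
  comp_mem m n f g hf hg := by
    obtain ⟨a, ha⟩ := Set.mem_iUnion.1 hf
    choose c hc using fun j => Set.mem_iUnion.1 (hg j)
    obtain ⟨M, hM⟩ := (Set.finite_range c).bddAbove
    exact Set.mem_iUnion.2 ⟨max a M, (hC _).comp_mem m n f g (hmono (le_max_left _ _) ha)
      fun j => hmono ((hM ⟨j, rfl⟩).trans (le_max_right _ _)) (hc j)⟩

theorem satisfiesACC_of_isFinitelyGenerated {A : Type*} {k : ℕ}
    (h : ∀ C : Set (KOp A k), IsKClone C → IsFinitelyGeneratedKClone C) :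
    SatisfiesACC {C : Set (KOp A k) // IsKClone C} := by
  intro p hp
  have hmono : Monotone fun n => (p n).1 := monotone_nat_of_le_succ hp
  obtain ⟨F, hF, hFC⟩ := h _ (IsKClone.iUnion_of_monotone (fun n => (p n).2) hmono)
  have hFsub : F ⊆ ⋃ n, (p n).1 := hFC ▸ (kClo_isLeast F).1.2
  obtain ⟨m, hm⟩ := hmono.directed_le.exists_mem_subset_of_finset_subset_biUnion 
    (s := hF.toFinset) (by simpa using hFsub)
  have hall : ⋃ n, (p n).1 ⊆ (p m).1 :=
    hFC ▸ (kClo_isLeast F).2 ⟨(p m).2, by simpa using hm⟩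
  exact ⟨m, fun n hn => Subtype.ext
    ((hmono hn).antisymm ((Set.subset_iUnion (fun n => (p n).1) n).trans hall))⟩

theorem mainTheorem4 (k : ℕ) (hk : 1 ≤ k) :
    (∀ C : Set (KOp (Fin 2) k), IsKClone C → IsFinitelyGeneratedKClone C) ∧
      SatisfiesACC {C : Set (KOp (Fin 2) k) // IsKClone C} :=
  ⟨fun _ hC => hC.isFinitelyGenerated,
    satisfiesACC_of_isFinitelyGenerated fun _ hC => hC.isFinitelyGenerated⟩
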